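/- Let $n\ge 1$, $q=2^n$, let $\alpha\in\mathbb F_q^*$, and let $F_{0,\alpha}$ be the permutation of $\mathbb F_q$ with $F_{0,\alpha}(0)=\alpha^{-1}$, $F_{0,\alpha}(\alpha)=0$ and $F_{0,\alpha}(x)=x^{-1}$ for $x\neq 0,\alpha$ (the inverse function $x\mapsto x^{q-2}$ followed by the transposition of $0$ and $\alpha^{-1}$). For $G:\mathbb F_q\to\mathbb F_q$ let $$VF_G=\{\{x,y,z,x+y+z\}: x,y,z\in\mathbb F_q \text{ pairwise distinct},\ G(x)+G(y)+G(z)+G(x+y+z)=0\}$$ be its set of vanishing flats (the set of blocks of the partial quadruple system $(\mathbb F_q,VF_G)$ associated to $G$), and let its row spectrum be the set of all $a\in\mathbb F_q^*$ such that for every $b\in\mathbb F_q$ the equation $G(x)+G(x+a)=b$ has either $0$ or $2$ solutions $x\in\mathbb F_q$. Let $k$ be the cardinality of the row spectrum of $F_{0,\alpha}$, let ${\rm Tr}:\mathbb F_q\to\mathbb F_2$ be the absolute trace and, for $c\in\mathbb F_q$, let $R_c=\{r\in\mathbb F_q: r^2+r+c=0\}$. For $a\in\mathbb F_q\setminus\{0,\alpha\}$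 let $\rho_a$ and $\mu_a$ be arbitrarily chosen elements of $R_{\alpha/(a+\alpha)}$ and of $R_{(a+\alpha)/a}$, respectively, whenever these sets are non-empty. For $E\subseteq\mathbb F_q$ with $0,\alpha\in E$ and $t\in\mathbb F_2$ put $$A_E=\left\{\{0,a,a\rho_a,a\rho_a+a\}: a\in\mathbb F_q\setminus E,\ {\rm Tr}\left(\tfrac{\alpha}{a+\alpha}\right)=0\right\},$$ $$B_{E,t}=\left\{\{\alpha,\alpha+a,a\mu_a,a\mu_a+a\}: a\in\mathbb F_q\setminus E,\ {\rm Tr}\left(\tfrac{\alpha}{a}\right)=t\right\}.$$ (The sets $R_c$ used below are non-empty, so the description makes sense for every choice of the roots.) I. If $n$ is odd, then $$VF_{F_{0,\alpha}}=A_{\{0,\alpha\}}\cup B_{\{0,\alpha\},1}\quad\text{and}\quad |VF_{F_{0,\alpha}}|=\tfrac13(q+\ell-k-1),$$ where $\ell=|\{a\in\mathbb F_q\setminus\{0,\alpha\}: {\rm Tr}(\frac{\alpha}{a+\alpha})=0,\ {\rm Tr}(\frac{\alpha}{a})=1\}|$. II. Suppose that $n$ is even. Let $\omega\in\mathbb F_4\setminus\mathbb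 F_2$, let $E=\{0,\alpha,\alpha\omega,\alpha\omega^2\}$, and let $s=|\{a\in\mathbb F_q\setminus E: {\rm Tr}(\frac{\alpha}{a+\alpha})={\rm Tr}(\frac{\alpha}{a})=0\}|$. II.i. If $n\equiv 2\pmod 4$, then $$VF_{F_{0,\alpha}}=\{E\}\cup A_E\cup B_{E,0}\quad\text{and}\quad |VF_{F_{0,\alpha}}|=\tfrac13(q+s-k-1).$$ II.ii. If $n\equiv 0\pmod 4$, then for all $\nu\in R_\omega$ and $\eta\in R_{\omega^2}$ $$\begin{aligned}VF_{F_{0,\alpha}}=\{&E,\ \{0,\alpha\omega,\alpha\omega\nu,\alpha\omega(\nu+1)\},\ \{\alpha,\alpha\omega^2,\alpha\omega\nu,\alpha\omega(\nu+1)\},\\ &\{0,\alpha\omega^2,\alpha\omega^2\eta,\alpha\omega^2(\eta+1)\},\ \{\alpha,\alpha\omega,\alpha\omega^2\eta,\alpha\omega^2(\eta+1)\}\}\cup A_E\cup B_{E,0},\end{aligned}$$ and $|VF_{F_{0,\alpha}}|=\tfrac13(q+s-k+3)$. -/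

import Mathlib

/-- The set of vanishing flats of `G` (the blocks of the partial quadruple system associated
to `G`): all `{x, y, z, x + y + z}` with `x, y, z` pairwise distinct and
`G x + G y + G z + G (x + y + z) = 0`. -/
def vanishingFlats {F : Type*} [Field F] (G : F → F) : Set (Set F) :=
  {S | ∃ x y z : F, x ≠ y ∧ x ≠ z ∧ y ≠ z ∧
    G x + G y + G z + G (x + y + z) = 0 ∧ S = {x, y, z, x + y + z}}

/-- The property `(p_a)`: `G x + G (x + a) = b` has either 0 or 2 solutions for every `b`. -/
def PropertyP {F : Type*} [Field F] (G : F → F) (a : F) : Prop :=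
  ∀ b : F, {x : F | G x + G (x + a) = b}.ncard = 0 ∨ {x : F | G x + G (x + a) = b}.ncard = 2

/-- The row spectrum of `G`: the nonzero `a` for which `G` satisfies `(p_a)`. -/
def rowSpectrum {F : Type*} [Field F] (G : F → F) : Set F :=
  {a | a ≠ 0 ∧ PropertyP G a}

/-- The absolute trace. -/
noncomputable def absTrace {F : Type*} [Field F] [Algebra (ZMod 2) F] (z : F) : ZMod 2 :=
  Algebra.trace (ZMod 2) F z

/-- The roots in `F` of the polynomial `a X ^ 2 + b X + c`. -/
def quadRoots {F : Type*} [Field F] (a b c : F) : Set F :=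
  {r | a * r ^ 2 + b * r + c = 0}

/-- `r` is a root of `X ^ 2 + X + c` as soon as this polynomial has a root in `F`. -/
def IsRootChoice {F : Type*} [Field F] (c r : F) : Prop :=
  (quadRoots 1 1 c).Nonempty → r ∈ quadRoots 1 1 c

/-- The elements of `F` that lie in `𝔽₄ ∖ 𝔽₂`. -/
def F4DiffF2 (F : Type*) [Field F] : Set F :=
  {w | w ^ 4 = w ∧ w ≠ 0 ∧ w ≠ 1}

open Classical in
/-- The inverse permutation `x ↦ x⁻¹` (with `0⁻¹ = 0`), followed by the transposition of
`0` and `α⁻¹`. -/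
noncomputable def modifiedInverse {F : Type*} [Field F] (α : F) (x : F) : F :=
  Equiv.swap 0 α⁻¹ x⁻¹

theorem modifiedInverse_zero {F : Type*} [Field F] (α : F) :
    modifiedInverse α 0 = α⁻¹ := by
  simp [modifiedInverse]

theorem modifiedInverse_self {F : Type*} [Field F] (α : F) :
    modifiedInverse α α = 0 := by
  simp [modifiedInverse]

theorem modifiedInverse_of_ne {F : Type*} [Field F] (α x : F) (h0 : x ≠ 0) (hα : x ≠ α) :
    modifiedInverse α x = x⁻¹ := by
  classical
  unfold modifiedInverse
  rw [Equiv.swap_apply_of_ne_of_ne (inv_ne_zero h0) (fun h => hα (inv_injective h))]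

/-- For `n ≥ 2` the map `x ↦ x⁻¹` (with `0⁻¹ = 0`) is the power map `x ↦ x ^ (2 ^ n - 2)`. -/
theorem inv_eq_pow_two_pow_sub_two {F : Type*} [Field F] [Fintype F] (n : ℕ) (hn : 2 ≤ n)
    (hF : Fintype.card F = 2 ^ n) (x : F) : x⁻¹ = x ^ (2 ^ n - 2) := by
  have h4 : 4 ≤ 2 ^ n := by
    calc 4 = 2 ^ 2 := by norm_num
      _ ≤ 2 ^ n := Nat.pow_le_pow_right (by norm_num) hn
  rcases eq_or_ne x 0 with rfl | hx
  · rw [inv_zero, zero_pow (by omega)]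
  · have h := FiniteField.pow_card_sub_one_eq_one x hx
    rw [hF] at h
    apply inv_eq_of_mul_eq_one_right
    rw [← pow_succ', ← h]
    congr 1
    omega

/-! ### The absolute trace and solvability of `r ^ 2 + r = c` -/

section Trace

variable {F : Type*} [Field F] [Algebra (ZMod 2) F]

/-! If four points with sum zero avoid `0` and `α`, clearing denominators in the sum of their
inverses leaves `(x + y)(x + z)(y + z) = 0`, so every vanishing flat meets `{0, α}`. A flat through
`0` and `a` but not `α` is `{0, a, a r, a r + a}` with `r² + r = α/(a + α)`; one through `α` and `α
+ a` but not `0` is `{α, α + a, a r, a r + a}` with `r² + r = (a + α)/a = 1 + α/a`; one through both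
comes from `w² + w = 1`. The two roots of such an equation differ by 1 and give the same flat, and
by additive Hilbert 90 they exist iff the right side has trace 0. Since `Tr 1 = n`, the parity of
`n` decides the condition on `Tr(α/a)` and whether `E` exists.

For the count, let `Z` and `S` be the directions `a` admitted by the first two equations. Flats of
one kind share only their base point, so each accounts for three directions, and `3|VF| = 3|both| +
|Z ∪ S| + |Z ∩ S|`. Property `(p_a)` fails exactly when `a` is a difference inside a flat, and the
difference can be taken from the base point; hence the complement of the row spectrum is `{0} ∪ Z ∪
S`, together with `E` for even `n`. For even `n`, `αω` and `αω²` lie in both `Z` and `S` or in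
neither, according to `Tr ω = n/2`; this separates the two residues modulo 4. -/

theorem two_eq_zero_of_algebra_zmod_two (F : Type*) [Field F] [Algebra (ZMod 2) F] :
    (2 : F) = 0 := by
  have h : algebraMap (ZMod 2) F 2 = 0 := by
    rw [show (2 : ZMod 2) = 0 from rfl, map_zero]
  rwa [map_ofNat] at h

theorem absTrace_add (x y : F) : absTrace (x + y) = absTrace x + absTrace y :=
  map_add _ _ _

/-- The map `r ↦ r ^ 2 + r` as a linear map over the prime field. -/
def sqAddSelf (F : Type*) [Field F] [Algebra (ZMod 2) F] : F →ₗ[ZMod 2] F :=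
  AddMonoidHom.toZModLinearMap 2
    { toFun := fun r => r ^ 2 + r
      map_zero' := by simp
      map_add' := fun x y => by
        linear_combination (x * y) * two_eq_zero_of_algebra_zmod_two F }

theorem sqAddSelf_apply (r : F) : sqAddSelf F r = r ^ 2 + r := rfl

theorem finrank_ker_sqAddSelf_le :
    Module.finrank (ZMod 2) (LinearMap.ker (sqAddSelf F)) ≤ 1 := by
  refine finrank_le_one ⟨1, ?_⟩ ?_
  · rw [LinearMap.mem_ker, sqAddSelf_apply]
    linear_combination two_eq_zero_of_algebra_zmod_two F
  · rintro ⟨v, hv⟩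
    rw [LinearMap.mem_ker, sqAddSelf_apply] at hv
    have h : v * (v + 1) = 0 := by linear_combination hv
    rcases mul_eq_zero.mp h with h | h
    · exact ⟨0, Subtype.ext (by simp [h])⟩
    · refine ⟨1, Subtype.ext ?_⟩
      simp only [one_smul]
      linear_combination two_eq_zero_of_algebra_zmod_two F - h

variable [Fintype F]

theorem finrank_zmod_two_of_card {n : ℕ} (hF : Fintype.card F = 2 ^ n) :
    Module.finrank (ZMod 2) F = n := by
  have h := Module.card_eq_pow_finrank (K := ZMod 2) (V := F)
  rw [hF, ZMod.card] at h
  exact (Nat.pow_right_injective le_rfl h).symm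

theorem algebraMap_absTrace {n : ℕ} (hF : Fintype.card F = 2 ^ n) (x : F) :
    algebraMap (ZMod 2) F (absTrace x) = ∑ i ∈ Finset.range n, x ^ 2 ^ i := by
  have h := FiniteField.algebraMap_trace_eq_sum_pow (ZMod 2) F x
  rwa [finrank_zmod_two_of_card hF, Nat.card_eq_fintype_card, ZMod.card] at h

theorem absTrace_one {n : ℕ} (hF : Fintype.card F = 2 ^ n) : absTrace (1 : F) = n := by
  have h := Algebra.trace_algebraMap (S := F) (1 : ZMod 2)
  rw [map_one, finrank_zmod_two_of_card hF] at h
  simpa [absTrace] using h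

theorem absTrace_sq (x : F) : absTrace (x ^ 2) = absTrace x := by
  have h2 := two_eq_zero_of_algebra_zmod_two F
  have hF := Module.card_eq_pow_finrank (K := ZMod 2) (V := F)
  rw [ZMod.card] at hF
  apply (algebraMap (ZMod 2) F).injective
  rw [algebraMap_absTrace hF, algebraMap_absTrace hF]
  -- Squaring shifts the sum of conjugates by one place; the term gained, `x ^ q`, equals the term
  -- lost, `x`.
  have h := Finset.sum_range_succ' (fun i => x ^ 2 ^ i) (Module.finrank (ZMod 2) F)
  rw [Finset.sum_range_succ, ← hF, FiniteField.pow_card] at h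
  simp only [pow_zero, pow_one] at h
  rw [add_right_cancel h]
  refine Finset.sum_congr rfl fun i _ => ?_
  rw [← pow_mul, pow_succ']

/-- Additive Hilbert 90 over the prime field with two elements. -/
theorem absTrace_eq_zero_iff (c : F) : absTrace c = 0 ↔ ∃ r : F, r ^ 2 + r = c := by
  have h2 := two_eq_zero_of_algebra_zmod_two F
  have hle : LinearMap.range (sqAddSelf F) ≤ LinearMap.ker (Algebra.trace (ZMod 2) F) := by
    rintro _ ⟨r, rfl⟩
    have h : absTrace (r ^ 2 + r) = 0 := by
      rw [absTrace_add, absTrace_sq, CharTwo.add_self_eq_zero]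
    exact h
  -- The image of `r ↦ r ^ 2 + r` has codimension at most 1 and lies in the trace kernel, whose
  -- codimension is exactly 1, so the two agree.
  have hr := LinearMap.finrank_range_add_finrank_ker (sqAddSelf F)
  have ht := LinearMap.finrank_range_add_finrank_ker (Algebra.trace (ZMod 2) F)
  rw [LinearMap.range_eq_top.mpr (Algebra.trace_surjective (ZMod 2) F), finrank_top,
    Module.finrank_self] at ht
  have hk := finrank_ker_sqAddSelf_le (F := F)
  have heq := Submodule.eq_of_le_of_finrank_le hle (by omega)
  have : c ∈ LinearMap.range (sqAddSelf F) ↔ c ∈ LinearMap.ker (Algebra.trace (ZMod 2) F) := by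
    rw [heq]
  exact this.symm

/-- The conjugates of `w` alternate between `w` and `w ^ 2`, so the `n` terms of the trace form `n /
2` consecutive pairs, each summing to 1. -/
theorem absTrace_eq_half {n : ℕ} (hF : Fintype.card F = 2 ^ n) (hn : Even n) {w : F}
    (hw : w ^ 2 + w = 1) : absTrace w = (n / 2 : ℕ) := by
  have h2 := two_eq_zero_of_algebra_zmod_two F
  apply (algebraMap (ZMod 2) F).injective
  rw [algebraMap_absTrace hF, map_natCast]
  obtain ⟨m, rfl⟩ := hn
  have hm : (m + m) / 2 = m := by omega
  rw [hm]
  clear hF hm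
  have h4 : w ^ 4 = w := by
    linear_combination (w ^ 2 - w + 2) * hw + (1 - 2 * w) * h2
  have hpow : ∀ k : ℕ, w ^ 2 ^ (k + k) = w := by
    intro k
    induction k with
    | zero => simp
    | succ k ih =>
      rw [show k + 1 + (k + 1) = (k + k) + 2 by ring, pow_add, pow_mul, ih]
      exact h4
  induction m with
  | zero => simp
  | succ k ih =>
    rw [show k + 1 + (k + 1) = (k + k) + 1 + 1 by ring, Finset.sum_range_succ,
      Finset.sum_range_succ, ih, pow_succ 2 (k + k), pow_mul, hpow]
    push_cast
    linear_combination hw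

end Trace

/-! ### Vanishing flats of an arbitrary function in characteristic 2 -/

section Flats

variable {F : Type*} [Field F] {G : F → F} {S : Set F}

/-- In characteristic 2 each point of a flat is the sum of the other three, so any two of them can
play the first two roles. -/
theorem exists_of_mem_vanishingFlats (h2 : (2 : F) = 0) (hS : S ∈ vanishingFlats G) {p q : F}
    (hp : p ∈ S) (hq : q ∈ S) (hpq : p ≠ q) :
    ∃ c, c ≠ p ∧ c ≠ q ∧ G p + G q + G c + G (p + q + c) = 0 ∧ S = {p, q, c, p + q + c} := by
  obtain ⟨x, y, z, hxy, hxz, hyz, h0, rfl⟩ := hS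
  simp only [Set.mem_insert_iff, Set.mem_singleton_iff] at hp hq
  simp only [Set.ext_iff, Set.mem_insert_iff, Set.mem_singleton_iff]
  rcases hp with rfl | rfl | rfl | rfl <;> rcases hq with rfl | rfl | rfl | rfl
  all_goals first
    | exact absurd rfl hpq
    | exact ⟨x, by grind, by grind, by grind, by grind⟩
    | exact ⟨y, by grind, by grind, by grind, by grind⟩
    | exact ⟨z, by grind, by grind, by grind, by grind⟩

theorem exists_ne_mem_of_mem_vanishingFlats (hS : S ∈ vanishingFlats G) (p : F) :
    ∃ q ∈ S, p ≠ q := by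
  obtain ⟨x, y, z, hxy, -, -, -, rfl⟩ := hS
  by_cases h : p = x
  · exact ⟨y, by simp, h ▸ hxy⟩
  · exact ⟨x, by simp, h⟩

theorem ncard_of_mem_vanishingFlats (h2 : (2 : F) = 0) (hS : S ∈ vanishingFlats G) :
    S.ncard = 4 := by
  obtain ⟨x, y, z, hxy, hxz, hyz, -, rfl⟩ := hS
  have hz : z ≠ x + y + z := by grind
  rw [Set.ncard_insert_of_notMem, Set.ncard_insert_of_notMem, Set.ncard_pair hz]
  all_goals
    simp only [Set.mem_insert_iff, Set.mem_singleton_iff]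
    grind

/-- A flat is a coset of a two-dimensional space over the prime field, hence stable under
translation by its differences. -/
theorem add_mem_of_mem_vanishingFlats (h2 : (2 : F) = 0) (hS : S ∈ vanishingFlats G) {p x a : F}
    (hp : p ∈ S) (hx : x ∈ S) (hxa : x + a ∈ S) : p + a ∈ S := by
  by_cases ha : a = 0
  · simpa [ha] using hp
  obtain ⟨c, -, -, -, rfl⟩ := exists_of_mem_vanishingFlats h2 hS hx hxa (by simpa using ha)
  simp only [Set.mem_insert_iff, Set.mem_singleton_iff] at hp ⊢
  grind

/-- Solutions of `G x + G (x + a) = b` come in pairs `{x, x + a}`; two distinct pairs for the same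
`b` form a vanishing flat. -/
theorem not_propertyP_iff [Finite F] (h2 : (2 : F) = 0) {a : F} (ha : a ≠ 0) :
    ¬ PropertyP G a ↔ ∃ S ∈ vanishingFlats G, ∃ x ∈ S, x + a ∈ S := by
  constructor
  · intro h
    simp only [PropertyP, not_forall, not_or] at h
    obtain ⟨b, hb0, hb2⟩ := h
    obtain ⟨x, hx⟩ := Set.nonempty_of_ncard_ne_zero hb0
    have hxa : x ≠ x + a := by simpa using ha
    obtain ⟨c, hc, hcx⟩ : ∃ c ∈ {x | G x + G (x + a) = b}, c ∉ ({x, x + a} : Set F) := by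
      by_contra! hcon
      refine hb2 ?_
      rw [← Set.ncard_pair hxa]
      congr 1
      refine Set.Subset.antisymm hcon ?_
      simp only [Set.mem_ofPred_eq, Set.insert_subset_iff, Set.singleton_subset_iff] at hx ⊢
      grind
    simp only [Set.mem_ofPred_eq, Set.mem_insert_iff, Set.mem_singleton_iff, not_or] at hx hc hcx
    refine ⟨{x, x + a, c, x + (x + a) + c}, ⟨x, x + a, c, hxa, Ne.symm hcx.1, Ne.symm hcx.2, ?_,
      rfl⟩, x, by simp, by simp⟩
    grind
  · rintro ⟨S, hS, x, hx, hxa⟩ hP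
    have hne : x ≠ x + a := by simpa using ha
    obtain ⟨c, hc1, hc2, h0, -⟩ := exists_of_mem_vanishingFlats h2 hS hx hxa hne
    have hsub : ({c, x, x + a} : Set F) ⊆ {y | G y + G (y + a) = G x + G (x + a)} := by
      simp only [Set.mem_ofPred_eq, Set.insert_subset_iff, Set.singleton_subset_iff]
      grind
    have hle := Set.ncard_le_ncard hsub
    rw [Set.ncard_insert_of_notMem (by simp [hc1, hc2]), Set.ncard_pair hne] at hle
    rcases hP (G x + G (x + a)) with h | h <;> omega

/-- If distinct members of a family of four-element sets meet only in the common point `p`,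
then their union without `p` has three times as many elements as the family has members. -/
theorem ncard_sUnion_sdiff_singleton {X : Type*} [Finite X] (T : Set (Set X)) (p : X)
    (h4 : ∀ S ∈ T, p ∈ S ∧ S.ncard = 4)
    (hu : ∀ S ∈ T, ∀ S' ∈ T, ∀ x, x ≠ p → x ∈ S → x ∈ S' → S = S') :
    (⋃₀ T \ {p}).ncard = 3 * T.ncard := by
  classical
  have := Fintype.ofFinite X
  have hT := T.toFinite
  have hun : ⋃₀ T \ {p} = ↑(hT.toFinset.biUnion fun S => (S \ {p}).toFinset) := by
    ext x
    simp only [Set.mem_sdiff, Set.mem_sUnion, Set.mem_singleton_iff, Finset.coe_biUnion,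
      Set.Finite.coe_toFinset, Set.coe_toFinset, Set.mem_iUnion, exists_prop]
    tauto
  rw [hun, Set.ncard_coe_finset, Finset.card_biUnion, Finset.sum_const_nat (m := 3),
    Set.ncard_eq_toFinset_card T hT, mul_comm]
  · intro S hS
    have h := h4 S (by simpa using hS)
    rw [← Set.ncard_eq_toFinset_card', Set.ncard_sdiff_singleton_of_mem h.1, h.2]
  · intro S hS S' hS' hne
    rw [Function.onFun_apply, Finset.disjoint_left]
    intro x hx hx'
    simp only [Set.mem_toFinset, Set.mem_sdiff, Set.mem_singleton_iff] at hx hx'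
    exact hne (hu S (by simpa using hS) S' (by simpa using hS') x hx.2 hx.1 hx'.1)

end Flats

/-! ### Flats of the modified inverse and their quadratic equations -/

section ModifiedInverse

variable {F : Type*} [Field F] {α : F} {S : Set F}

theorem not_zero_mem_or_mem_of_mem_vanishingFlats (h2 : (2 : F) = 0)
    (hS : S ∈ vanishingFlats (modifiedInverse α)) : (0 : F) ∈ S ∨ α ∈ S := by
  by_contra! hcon
  obtain ⟨x, y, z, hxy, hxz, hyz, h0, rfl⟩ := hS
  simp only [Set.mem_insert_iff, Set.mem_singleton_iff, not_or] at hcon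
  obtain ⟨⟨hx, hy, hz, hw⟩, hx', hy', hz', hw'⟩ := hcon
  rw [modifiedInverse_of_ne _ _ (Ne.symm hx) (Ne.symm hx'),
    modifiedInverse_of_ne _ _ (Ne.symm hy) (Ne.symm hy'),
    modifiedInverse_of_ne _ _ (Ne.symm hz) (Ne.symm hz'),
    modifiedInverse_of_ne _ _ (Ne.symm hw) (Ne.symm hw')] at h0
  have h : (x + y) * (x + z) * (y + z) = 0 := by
    have := Ne.symm hx
    have := Ne.symm hy
    have := Ne.symm hz
    have := Ne.symm hw
    field_simp at h0
    grind
  grind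

/-- With third point `c` and `r = c / a`, the condition `α⁻¹ + a⁻¹ + c⁻¹ + (c + a)⁻¹ = 0` becomes
the quadratic. -/
theorem mem_vanishingFlats_of_zero_mem_iff (h2 : (2 : F) = 0) (hα : α ≠ 0) {a : F} (ha : a ≠ 0) :
    (S ∈ vanishingFlats (modifiedInverse α) ∧ (0 : F) ∈ S ∧ α ∉ S) ∧ a ∈ S ↔
      a ≠ α ∧ ∃ r, r ^ 2 + r = α / (a + α) ∧ S = {0, a, a * r, a * r + a} := by
  constructor
  · rintro ⟨⟨hS, h0S, hαS⟩, haS⟩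
    obtain ⟨c, hc0, hca, hG, rfl⟩ := exists_of_mem_vanishingFlats h2 hS h0S haS (Ne.symm ha)
    simp only [Set.mem_insert_iff, Set.mem_singleton_iff, not_or] at hαS
    obtain ⟨-, haα, hcα, hdα⟩ := hαS
    have hd : 0 + a + c ≠ 0 := by grind
    rw [modifiedInverse_zero, modifiedInverse_of_ne _ _ ha (Ne.symm haα),
      modifiedInverse_of_ne _ _ hc0 (Ne.symm hcα),
      modifiedInverse_of_ne _ _ hd (Ne.symm hdα)] at hG
    have haα' : a + α ≠ 0 := by grind
    refine ⟨Ne.symm haα, c / a, ?_, ?_⟩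
    · rw [zero_add] at hd hG
      field_simp at hG ⊢
      grind
    · rw [mul_div_cancel₀ _ ha, zero_add, add_comm c a]
  · rintro ⟨haα, r, hr, rfl⟩
    have haα' : a + α ≠ 0 := by grind
    rw [eq_div_iff haα'] at hr
    have hr0 : r ≠ 0 := by grind
    have hr1 : r + 1 ≠ 0 := by grind
    have hd : a * r + a ≠ 0 := by
      rw [show a * r + a = a * (r + 1) by ring]
      exact mul_ne_zero ha hr1
    have hc : a * r ≠ 0 := mul_ne_zero ha hr0
    -- Substituting `a * r = α` into the quadratic forces `α * r = 0`; in the next case it forces `r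
    -- = 1`.
    have hcα : a * r ≠ α := by grind
    have hdα : a * r + a ≠ α := by grind
    refine ⟨⟨⟨0, a, a * r, Ne.symm ha, Ne.symm hc, by grind, ?_, ?_⟩, by simp, ?_⟩, by simp⟩
    · rw [show 0 + a + a * r = a * r + a by ring, modifiedInverse_zero,
        modifiedInverse_of_ne _ _ ha haα, modifiedInverse_of_ne _ _ hc hcα,
        modifiedInverse_of_ne _ _ hd hdα]
      rw [show a * r + a = a * (r + 1) by ring]
      field_simp
      grind
    · rw [show 0 + a + a * r = a * r + a by ring]
    · simp only [Set.mem_insert_iff, Set.mem_singleton_iff, not_or]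
      exact ⟨hα, Ne.symm haα, Ne.symm hcα, Ne.symm hdα⟩

/-- Here `α` contributes 0, so with `r = c / a` the equation is `(α + a)⁻¹ + c⁻¹ + (c + a)⁻¹ = 0`.
-/
theorem mem_vanishingFlats_of_self_mem_iff (h2 : (2 : F) = 0) (hα : α ≠ 0) {a : F} (ha : a ≠ 0) :
    (S ∈ vanishingFlats (modifiedInverse α) ∧ α ∈ S ∧ (0 : F) ∉ S) ∧ α + a ∈ S ↔
      a ≠ α ∧ ∃ r, r ^ 2 + r = (a + α) / a ∧ S = {α, α + a, a * r, a * r + a} := by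
  constructor
  · rintro ⟨⟨hS, hαS, h0S⟩, haS⟩
    obtain ⟨c, hcα, hca, hG, rfl⟩ := exists_of_mem_vanishingFlats h2 hS hαS haS (by simpa using ha)
    simp only [Set.mem_insert_iff, Set.mem_singleton_iff, not_or] at h0S
    obtain ⟨-, ha0, hc0, hd0⟩ := h0S
    have hd : α + (α + a) + c = c + a := by grind
    have hdα : c + a ≠ α := by grind
    rw [hd] at hd0 hG
    rw [modifiedInverse_self, modifiedInverse_of_ne _ _ (Ne.symm ha0) (by simpa using ha),
      modifiedInverse_of_ne _ _ (Ne.symm hc0) hcα,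
      modifiedInverse_of_ne _ _ (Ne.symm hd0) hdα] at hG
    have haα := Ne.symm ha0
    have hc := Ne.symm hc0
    have hda := Ne.symm hd0
    refine ⟨by grind, c / a, ?_, ?_⟩
    · field_simp at hG ⊢
      grind
    · rw [mul_div_cancel₀ _ ha, hd]
  · rintro ⟨haα, r, hr, rfl⟩
    have haα' : α + a ≠ 0 := by grind
    rw [eq_div_iff ha] at hr
    have hr0 : r ≠ 0 := by grind
    have hr1 : r + 1 ≠ 0 := by grind
    have hd : a * r + a ≠ 0 := by
      rw [show a * r + a = a * (r + 1) by ring]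
      exact mul_ne_zero ha hr1
    have hc : a * r ≠ 0 := mul_ne_zero ha hr0
    have hcα : a * r ≠ α := by grind
    have hdα : a * r + a ≠ α := by grind
    have hs : α + (α + a) + a * r = a * r + a := by grind
    have hne : α + a ≠ α := by simpa using ha
    refine ⟨⟨⟨α, α + a, a * r, Ne.symm hne, Ne.symm hcα, by grind, ?_, ?_⟩, by simp, ?_⟩, by simp⟩
    · rw [hs, modifiedInverse_self,
        modifiedInverse_of_ne _ _ haα' hne, modifiedInverse_of_ne _ _ hc hcα,
        modifiedInverse_of_ne _ _ hd hdα]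
      rw [show a * r + a = a * (r + 1) by ring]
      field_simp
      grind
    · rw [hs]
    · simp only [Set.mem_insert_iff, Set.mem_singleton_iff, not_or]
      exact ⟨Ne.symm hα, Ne.symm haα', Ne.symm hc, Ne.symm hd⟩

theorem mem_vanishingFlats_of_zero_mem_of_self_mem_iff (h2 : (2 : F) = 0) (hα : α ≠ 0) :
    S ∈ vanishingFlats (modifiedInverse α) ∧ (0 : F) ∈ S ∧ α ∈ S ↔
      ∃ w, w ^ 2 + w = 1 ∧ S = {0, α, α * w, α * w + α} := by
  constructor
  · rintro ⟨hS, h0S, hαS⟩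
    obtain ⟨c, hc0, hcα, hG, rfl⟩ := exists_of_mem_vanishingFlats h2 hS h0S hαS (Ne.symm hα)
    have hd : 0 + α + c = c + α := by ring
    have hd0 : c + α ≠ 0 := by grind
    rw [hd, modifiedInverse_zero, modifiedInverse_self, modifiedInverse_of_ne _ _ hc0 hcα,
      modifiedInverse_of_ne _ _ hd0 (by simpa using hc0)] at hG
    refine ⟨c / α, ?_, ?_⟩
    · field_simp at hG ⊢
      grind
    · rw [mul_div_cancel₀ _ hα, hd]
  · rintro ⟨w, hw, rfl⟩
    have hw0 : w ≠ 0 := by grind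
    have hw1 : w + 1 ≠ 0 := by grind
    have hc : α * w ≠ 0 := mul_ne_zero hα hw0
    have hd : α * w + α ≠ 0 := by
      rw [show α * w + α = α * (w + 1) by ring]
      exact mul_ne_zero hα hw1
    have hcα : α * w ≠ α := by grind
    refine ⟨⟨0, α, α * w, Ne.symm hα, Ne.symm hc, Ne.symm hcα, ?_, ?_⟩, by simp, by simp⟩
    · rw [show 0 + α + α * w = α * w + α by ring, modifiedInverse_zero, modifiedInverse_self,
        modifiedInverse_of_ne _ _ hc hcα, modifiedInverse_of_ne _ _ hd (by simpa using hc)]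
      rw [show α * w + α = α * (w + 1) by ring]
      field_simp
      grind
    · rw [show 0 + α + α * w = α * w + α by ring]

end ModifiedInverse

/-! ### The three families of flats, their directions and the row spectrum -/

section Families

variable {F : Type*} [Field F]

/-- The vanishing flats of `modifiedInverse α` that contain `0` but not `α`. -/
def zeroFlats (α : F) : Set (Set F) :=
  {S | S ∈ vanishingFlats (modifiedInverse α) ∧ (0 : F) ∈ S ∧ α ∉ S}

/-- The vanishing flats of `modifiedInverse α` that contain `α` but not `0`. -/
def selfFlats (α : F) : Set (Set F) :=
  {S | S ∈ vanishingFlats (modifiedInverse α) ∧ α ∈ S ∧ (0 : F) ∉ S}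

/-- The vanishing flats of `modifiedInverse α` that contain both `0` and `α`. -/
def bothFlats (α : F) : Set (Set F) :=
  {S | S ∈ vanishingFlats (modifiedInverse α) ∧ (0 : F) ∈ S ∧ α ∈ S}

variable {α : F}

theorem vanishingFlats_modifiedInverse (h2 : (2 : F) = 0) :
    vanishingFlats (modifiedInverse α) = bothFlats α ∪ zeroFlats α ∪ selfFlats α := by
  ext S
  have h := not_zero_mem_or_mem_of_mem_vanishingFlats (α := α) (S := S) h2
  simp only [bothFlats, zeroFlats, selfFlats, Set.mem_union, Set.mem_ofPred_eq]
  tauto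

theorem ncard_vanishingFlats_modifiedInverse [Finite F] (h2 : (2 : F) = 0) :
    (vanishingFlats (modifiedInverse α)).ncard =
      (bothFlats α).ncard + (zeroFlats α).ncard + (selfFlats α).ncard := by
  rw [vanishingFlats_modifiedInverse h2, Set.ncard_union_eq, Set.ncard_union_eq]
  · rw [Set.disjoint_left]
    rintro S ⟨-, -, h⟩ ⟨-, -, h'⟩
    exact h' h
  · rw [Set.disjoint_left]
    rintro S (⟨-, h, -⟩ | ⟨-, h, -⟩) ⟨-, -, h'⟩ <;> exact h' h

/-- The two roots differ by 1, which only swaps the last two points. This gives both independence of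
the chosen root and uniqueness of the flat in a given direction. -/
theorem flat_eq_of_quadratic_eq (h2 : (2 : F) = 0) {p q a r r' : F}
    (h : r ^ 2 + r = r' ^ 2 + r') :
    ({p, q, a * r, a * r + a} : Set F) = {p, q, a * r', a * r' + a} := by
  have h : (r + r') * (r + r' + 1) = 0 := by grind
  rcases mul_eq_zero.mp h with h | h
  · rw [show r = r' by grind]
  · rw [show a * r = a * r' + a by grind, show a * r' + a + a = a * r' by grind,
      Set.pair_comm (a * r' + a)]

theorem bothFlats_eq_empty (h2 : (2 : F) = 0) (hα : α ≠ 0) (hw : ∀ w : F, w ^ 2 + w ≠ 1) :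
    bothFlats α = ∅ := by
  refine Set.eq_empty_of_forall_notMem fun S hS => ?_
  obtain ⟨w, hw', -⟩ := (mem_vanishingFlats_of_zero_mem_of_self_mem_iff h2 hα).mp hS
  exact hw w hw'

theorem bothFlats_eq_singleton (h2 : (2 : F) = 0) (hα : α ≠ 0) {w : F} (hw : w ^ 2 + w = 1) :
    bothFlats α = {{0, α, α * w, α * w ^ 2}} := by
  have hw2 : α * w ^ 2 = α * w + α := by grind
  ext S
  rw [Set.mem_singleton_iff, bothFlats, Set.mem_ofPred_eq,
    mem_vanishingFlats_of_zero_mem_of_self_mem_iff h2 hα, hw2]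
  constructor
  · rintro ⟨v, hv, rfl⟩
    exact flat_eq_of_quadratic_eq h2 (hv.trans hw.symm)
  · rintro rfl
    exact ⟨w, hw, rfl⟩

variable [Algebra (ZMod 2) F]

/-- The nonzero elements of the members of `zeroFlats α`. -/
def zeroDirections (α : F) : Set F :=
  {a | a ∉ ({0, α} : Set F) ∧ absTrace (α / (a + α)) = 0}

/-- The nonzero differences `a` for which `α + a` lies in a member of `selfFlats α`. -/
def selfDirections (α : F) : Set F :=
  {a | a ∉ ({0, α} : Set F) ∧ absTrace (α / a) = absTrace (1 : F)}

theorem absTrace_self_div_eq_iff {a : F} (ha : a ≠ 0) :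
    absTrace (α / a) = absTrace (1 : F) ↔ absTrace ((a + α) / a) = 0 := by
  rw [add_div, div_self ha, absTrace_add, CharTwo.add_eq_zero, eq_comm]

variable [Fintype F]

theorem mem_zeroDirections_iff (hα : α ≠ 0) {a : F} :
    a ∈ zeroDirections α ↔ a ≠ 0 ∧ ∃ S ∈ zeroFlats α, a ∈ S := by
  have h2 := two_eq_zero_of_algebra_zmod_two F
  rcases eq_or_ne a 0 with rfl | ha
  · simp [zeroDirections]
  simp only [zeroFlats, Set.mem_ofPred_eq, mem_vanishingFlats_of_zero_mem_iff h2 hα ha,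
    zeroDirections, absTrace_eq_zero_iff, Set.mem_insert_iff, Set.mem_singleton_iff]
  grind

theorem mem_selfDirections_iff (hα : α ≠ 0) {a : F} :
    a ∈ selfDirections α ↔ a ≠ 0 ∧ ∃ S ∈ selfFlats α, α + a ∈ S := by
  have h2 := two_eq_zero_of_algebra_zmod_two F
  rcases eq_or_ne a 0 with rfl | ha
  · simp [selfDirections]
  simp only [selfFlats, Set.mem_ofPred_eq, mem_vanishingFlats_of_self_mem_iff h2 hα ha,
    selfDirections, absTrace_self_div_eq_iff ha, absTrace_eq_zero_iff, Set.mem_insert_iff,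
    Set.mem_singleton_iff]
  grind

theorem ncard_zeroDirections (hα : α ≠ 0) :
    (zeroDirections α).ncard = 3 * (zeroFlats α).ncard := by
  have h2 := two_eq_zero_of_algebra_zmod_two F
  rw [← ncard_sUnion_sdiff_singleton (zeroFlats α) 0]
  · congr 1
    ext a
    rw [mem_zeroDirections_iff hα, and_comm]
    rfl
  · exact fun S hS => ⟨hS.2.1, ncard_of_mem_vanishingFlats h2 hS.1⟩
  · intro S hS S' hS' x hx hxS hxS'
    obtain ⟨-, r, hr, rfl⟩ := (mem_vanishingFlats_of_zero_mem_iff h2 hα hx).mp ⟨hS, hxS⟩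
    obtain ⟨-, r', hr', rfl⟩ := (mem_vanishingFlats_of_zero_mem_iff h2 hα hx).mp ⟨hS', hxS'⟩
    exact flat_eq_of_quadratic_eq h2 (hr.trans hr'.symm)

theorem ncard_selfDirections (hα : α ≠ 0) :
    (selfDirections α).ncard = 3 * (selfFlats α).ncard := by
  have h2 := two_eq_zero_of_algebra_zmod_two F
  rw [← ncard_sUnion_sdiff_singleton (selfFlats α) α,
    -- Translation by `α` turns directions into the points other than `α` of the flats.
    ← Set.ncard_image_of_injective (selfDirections α) (add_right_injective α)]
  · congr 1
    ext x
    simp only [Set.mem_image, mem_selfDirections_iff hα, Set.mem_sdiff, Set.mem_sUnion,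
      Set.mem_singleton_iff]
    constructor
    · rintro ⟨a, ⟨ha, h⟩, rfl⟩
      exact ⟨h, by simpa using ha⟩
    · rintro ⟨h, hx⟩
      have e : α + (x - α) = x := by ring
      exact ⟨x - α, ⟨sub_ne_zero.mpr hx, by rwa [e]⟩, e⟩
  · exact fun S hS => ⟨hS.2.1, ncard_of_mem_vanishingFlats h2 hS.1⟩
  · intro S hS S' hS' x hx hxS hxS'
    obtain ⟨a, rfl⟩ : ∃ a, x = α + a := ⟨x - α, by ring⟩
    have ha : a ≠ 0 := by simpa using hx
    obtain ⟨-, r, hr, rfl⟩ := (mem_vanishingFlats_of_self_mem_iff h2 hα ha).mp ⟨hS, hxS⟩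
    obtain ⟨-, r', hr', rfl⟩ := (mem_vanishingFlats_of_self_mem_iff h2 hα ha).mp ⟨hS', hxS'⟩
    exact flat_eq_of_quadratic_eq h2 (hr.trans hr'.symm)

/-- A difference inside a flat translates the flat to itself, so it can be measured from whichever
of `0`, `α` the flat contains. -/
theorem compl_rowSpectrum_modifiedInverse (hα : α ≠ 0) :
    (rowSpectrum (modifiedInverse α))ᶜ =
      insert 0 (zeroDirections α ∪ selfDirections α ∪ ⋃₀ bothFlats α) := by
  have h2 := two_eq_zero_of_algebra_zmod_two F
  ext a
  rcases eq_or_ne a 0 with rfl | ha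
  · simp [rowSpectrum]
  have h : a ∈ (rowSpectrum (modifiedInverse α))ᶜ ↔ ¬ PropertyP (modifiedInverse α) a := by
    simp [rowSpectrum, ha]
  rw [h, not_propertyP_iff h2 ha]
  simp only [Set.mem_insert_iff, Set.mem_union, Set.mem_sUnion, mem_zeroDirections_iff hα,
    mem_selfDirections_iff hα, ha, false_or, ne_eq, not_false_eq_true, true_and]
  constructor
  · rintro ⟨S, hS, x, hx, hxa⟩
    have hp (p : F) (hp : p ∈ S) : p + a ∈ S := add_mem_of_mem_vanishingFlats h2 hS hp hx hxa
    by_cases h0 : (0 : F) ∈ S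
    · have h0a : a ∈ S := by simpa using hp 0 h0
      by_cases h1 : α ∈ S
      · exact .inr ⟨S, ⟨hS, h0, h1⟩, h0a⟩
      · exact .inl (.inl ⟨S, ⟨hS, h0, h1⟩, h0a⟩)
    · have h1 := (not_zero_mem_or_mem_of_mem_vanishingFlats h2 hS).resolve_left h0
      exact .inl (.inr ⟨S, ⟨hS, h1, h0⟩, hp α h1⟩)
  · rintro ((⟨S, hS, h⟩ | ⟨S, hS, h⟩) | ⟨S, hS, h⟩)
    · exact ⟨S, hS.1, 0, hS.2.1, by simpa using h⟩
    · exact ⟨S, hS.1, α, hS.2.1, h⟩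
    · exact ⟨S, hS.1, 0, hS.2.1, by simpa using h⟩

/-- Trace 0 makes the root set non-empty, so the conditional choice is a genuine root. -/
theorem quadratic_of_isRootChoice {c r : F} (hc : absTrace c = 0) (hr : IsRootChoice c r) :
    r ^ 2 + r = c := by
  have h2 := two_eq_zero_of_algebra_zmod_two F
  obtain ⟨s, hs⟩ := (absTrace_eq_zero_iff c).mp hc
  have h : 1 * r ^ 2 + 1 * r + c = 0 := hr ⟨s, show 1 * s ^ 2 + 1 * s + c = 0 by grind⟩
  grind

theorem mem_zeroFlats_iff (hα : α ≠ 0) {ρ : F → F}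
    (hρ : ∀ a : F, a ∉ ({0, α} : Set F) → IsRootChoice (α / (a + α)) (ρ a)) {S : Set F} :
    S ∈ zeroFlats α ↔ ∃ a ∈ zeroDirections α, S = {0, a, a * ρ a, a * ρ a + a} := by
  have h2 := two_eq_zero_of_algebra_zmod_two F
  constructor
  · intro hS
    obtain ⟨a, haS, ha⟩ := exists_ne_mem_of_mem_vanishingFlats hS.1 0
    have haD := (mem_zeroDirections_iff hα).mpr ⟨ha.symm, S, hS, haS⟩
    refine ⟨a, haD, ?_⟩
    obtain ⟨-, r, hr, rfl⟩ := (mem_vanishingFlats_of_zero_mem_iff h2 hα ha.symm).mp ⟨hS, haS⟩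
    exact flat_eq_of_quadratic_eq h2
      (hr.trans (quadratic_of_isRootChoice haD.2 (hρ a haD.1)).symm)
  · rintro ⟨a, ha, rfl⟩
    have ha0 : a ≠ 0 ∧ a ≠ α := by simpa using ha.1
    exact ((mem_vanishingFlats_of_zero_mem_iff h2 hα ha0.1).mpr
      ⟨ha0.2, _, quadratic_of_isRootChoice ha.2 (hρ a ha.1), rfl⟩).1

theorem mem_selfFlats_iff (hα : α ≠ 0) {μ : F → F}
    (hμ : ∀ a : F, a ∉ ({0, α} : Set F) → IsRootChoice ((a + α) / a) (μ a)) {S : Set F} :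
    S ∈ selfFlats α ↔ ∃ a ∈ selfDirections α, S = {α, α + a, a * μ a, a * μ a + a} := by
  have h2 := two_eq_zero_of_algebra_zmod_two F
  constructor
  · intro hS
    obtain ⟨x, hxS, hx⟩ := exists_ne_mem_of_mem_vanishingFlats hS.1 α
    obtain ⟨a, rfl⟩ : ∃ a, x = α + a := ⟨x - α, by ring⟩
    have ha : a ≠ 0 := by simpa using hx
    have haD := (mem_selfDirections_iff hα).mpr ⟨ha, S, hS, hxS⟩
    refine ⟨a, haD, ?_⟩
    obtain ⟨-, r, hr, rfl⟩ := (mem_vanishingFlats_of_self_mem_iff h2 hα ha).mp ⟨hS, hxS⟩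
    exact flat_eq_of_quadratic_eq h2 (hr.trans (quadratic_of_isRootChoice
      ((absTrace_self_div_eq_iff ha).mp haD.2) (hμ a haD.1)).symm)
  · rintro ⟨a, ha, rfl⟩
    have ha0 : a ≠ 0 ∧ a ≠ α := by simpa using ha.1
    exact ((mem_vanishingFlats_of_self_mem_iff h2 hα ha0.1).mpr
      ⟨ha0.2, _, quadratic_of_isRootChoice ((absTrace_self_div_eq_iff ha0.1).mp ha.2)
        (hμ a ha.1), rfl⟩).1

end Families

/-! ### Even degree: the flat `E` and the exceptional directions `αω`, `αω²` -/

section Even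

variable {F : Type*} [Field F] {α ω : F}

theorem sq_add_self_of_mem_F4DiffF2 (h2 : (2 : F) = 0) (hω : ω ∈ F4DiffF2 F) :
    ω ^ 2 + ω = 1 := by
  obtain ⟨h4, h0, h1⟩ := hω
  have h : ω * ((ω - 1) * (ω ^ 2 + ω + 1)) = 0 := by linear_combination h4
  have := ((mul_eq_zero.mp h).resolve_left h0)
  have := (mul_eq_zero.mp this).resolve_left (sub_ne_zero.mpr h1)
  linear_combination this - h2

theorem pairwise_ne_of_sq_add_self (h2 : (2 : F) = 0) (hα : α ≠ 0) (hω : ω ^ 2 + ω = 1) :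
    α * ω ≠ 0 ∧ α * ω ^ 2 ≠ 0 ∧ α * ω ≠ α ∧ α * ω ^ 2 ≠ α ∧ α * ω ≠ α * ω ^ 2 := by
  have hω0 : ω ≠ 0 := by grind
  refine ⟨mul_ne_zero hα hω0, mul_ne_zero hα (pow_ne_zero 2 hω0), ?_, ?_, ?_⟩ <;> grind

/-- All four follow from `ω + 1 = ω ^ 2` and `ω ^ 3 = 1`. They reduce the trace conditions at `αω`
and `αω²` to `Tr ω = 0`. -/
theorem div_eq_of_sq_add_self (h2 : (2 : F) = 0) (hα : α ≠ 0) (hω : ω ^ 2 + ω = 1) :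
    α / (α * ω + α) = ω ∧ α / (α * ω ^ 2 + α) = ω ^ 2 ∧
      α / (α * ω) = ω ^ 2 ∧ α / (α * ω ^ 2) = ω := by
  obtain ⟨h1, h2', h3, h4, -⟩ := pairwise_ne_of_sq_add_self h2 hα hω
  have h5 : α * ω + α ≠ 0 := by grind
  have h6 : α * ω ^ 2 + α ≠ 0 := by grind
  refine ⟨?_, ?_, ?_, ?_⟩ <;> rw [div_eq_iff (by assumption)] <;> grind

theorem add_div_eq_of_sq_add_self (h2 : (2 : F) = 0) (hα : α ≠ 0) (hω : ω ^ 2 + ω = 1) :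
    (α * ω + α) / (α * ω) = ω ∧ (α * ω ^ 2 + α) / (α * ω ^ 2) = ω ^ 2 := by
  obtain ⟨h1, h2', -⟩ := pairwise_ne_of_sq_add_self h2 hα hω
  refine ⟨?_, ?_⟩ <;> rw [div_eq_iff (by assumption)] <;> grind

theorem notMem_base_iff {a : F} :
    a ∉ ({0, α, α * ω, α * ω ^ 2} : Set F) ↔
      a ∉ ({0, α} : Set F) ∧ a ≠ α * ω ∧ a ≠ α * ω ^ 2 := by
  simp only [Set.mem_insert_iff, Set.mem_singleton_iff]
  tauto

theorem ncard_base [Finite F] (h2 : (2 : F) = 0) (hα : α ≠ 0) (hω : ω ^ 2 + ω = 1) :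
    ({0, α, α * ω, α * ω ^ 2} : Set F).ncard = 4 := by
  have hE : ({0, α, α * ω, α * ω ^ 2} : Set F) ∈ bothFlats α := by
    rw [bothFlats_eq_singleton h2 hα hω]
    rfl
  exact ncard_of_mem_vanishingFlats h2 hE.1

theorem ncard_rowSpectrum_add_ncard_compl [Fintype F] (α : F) {n : ℕ} (hF : Fintype.card F = 2 ^ n) :
    (rowSpectrum (modifiedInverse α)).ncard + (rowSpectrum (modifiedInverse α))ᶜ.ncard =
      2 ^ n := by
  rw [Set.ncard_add_ncard_compl, Nat.card_eq_fintype_card, hF]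

variable [Algebra (ZMod 2) F]

theorem common_directions_eq (h1 : absTrace (1 : F) = 0) :
    {a : F | a ∉ ({0, α, α * ω, α * ω ^ 2} : Set F) ∧
      absTrace (α / (a + α)) = 0 ∧ absTrace (α / a) = 0} =
      (zeroDirections α ∩ selfDirections α) \ {α * ω, α * ω ^ 2} := by
  ext a
  simp only [zeroDirections, selfDirections, Set.mem_ofPred_eq, h1,
    Set.mem_inter_iff, Set.mem_sdiff, Set.mem_insert_iff, Set.mem_singleton_iff]
  tauto

variable [Fintype F]

theorem absTrace_one_of_even {n : ℕ} (hF : Fintype.card F = 2 ^ n) (hn : Even n) :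
    absTrace (1 : F) = 0 := by
  rw [absTrace_one hF]
  exact (ZMod.natCast_eq_zero_iff_even).mpr hn

theorem exceptional_mem_zeroDirections_iff (hα : α ≠ 0) (hω : ω ^ 2 + ω = 1) :
    (α * ω ∈ zeroDirections α ↔ absTrace ω = 0) ∧
      (α * ω ^ 2 ∈ zeroDirections α ↔ absTrace ω = 0) := by
  have h2 := two_eq_zero_of_algebra_zmod_two F
  obtain ⟨h1, h2', h3, h4, -⟩ := pairwise_ne_of_sq_add_self h2 hα hω
  obtain ⟨e1, e2, -⟩ := div_eq_of_sq_add_self h2 hα hω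
  simp only [zeroDirections, Set.mem_ofPred_eq, Set.mem_insert_iff, Set.mem_singleton_iff,
    h1, h2', h3, h4, e1, e2, absTrace_sq, or_self, not_false_eq_true, true_and, and_self]

theorem exceptional_mem_selfDirections_iff (hα : α ≠ 0) (hω : ω ^ 2 + ω = 1)
    (h1 : absTrace (1 : F) = 0) :
    (α * ω ∈ selfDirections α ↔ absTrace ω = 0) ∧
      (α * ω ^ 2 ∈ selfDirections α ↔ absTrace ω = 0) := by
  have h2 := two_eq_zero_of_algebra_zmod_two F
  obtain ⟨h1', h2', h3, h4, -⟩ := pairwise_ne_of_sq_add_self h2 hα hω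
  obtain ⟨-, -, e1, e2⟩ := div_eq_of_sq_add_self h2 hα hω
  simp only [selfDirections, Set.mem_ofPred_eq, Set.mem_insert_iff, Set.mem_singleton_iff,
    h1', h2', h3, h4, e1, e2, absTrace_sq, h1, or_self, not_false_eq_true, true_and, and_self]

theorem compl_rowSpectrum_of_sq_add_self (hα : α ≠ 0) (hω : ω ^ 2 + ω = 1) :
    (rowSpectrum (modifiedInverse α))ᶜ =
      {0, α, α * ω, α * ω ^ 2} ∪ (zeroDirections α ∪ selfDirections α) := by
  rw [compl_rowSpectrum_modifiedInverse hα,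
    bothFlats_eq_singleton (two_eq_zero_of_algebra_zmod_two F) hα hω, Set.sUnion_singleton]
  ext a
  simp only [Set.mem_insert_iff, Set.mem_union, Set.mem_singleton_iff]
  tauto

/-- As `Tr ω ≠ 0`, neither exceptional direction is admissible, so excluding `E` instead of `{0, α}`
loses no flat. -/
theorem vanishingFlats_of_absTrace_ne_zero (hα : α ≠ 0) (hω : ω ^ 2 + ω = 1)
    (h1 : absTrace (1 : F) = 0) (ht : absTrace ω ≠ 0) {ρ μ : F → F}
    (hρ : ∀ a : F, a ∉ ({0, α} : Set F) → IsRootChoice (α / (a + α)) (ρ a))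
    (hμ : ∀ a : F, a ∉ ({0, α} : Set F) → IsRootChoice ((a + α) / a) (μ a)) :
    vanishingFlats (modifiedInverse α) =
      {{0, α, α * ω, α * ω ^ 2}} ∪
      {S : Set F | ∃ a : F, a ∉ ({0, α, α * ω, α * ω ^ 2} : Set F) ∧
        absTrace (α / (a + α)) = 0 ∧ S = {0, a, a * ρ a, a * ρ a + a}} ∪
      {S : Set F | ∃ a : F, a ∉ ({0, α, α * ω, α * ω ^ 2} : Set F) ∧
        absTrace (α / a) = 0 ∧ S = {α, α + a, a * μ a, a * μ a + a}} := by
  have h2 := two_eq_zero_of_algebra_zmod_two F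
  obtain ⟨z1, z2⟩ := exceptional_mem_zeroDirections_iff hα hω
  obtain ⟨s1, s2⟩ := exceptional_mem_selfDirections_iff hα hω h1
  rw [vanishingFlats_modifiedInverse h2, bothFlats_eq_singleton h2 hα hω]
  congr 1
  · congr 1
    ext S
    rw [mem_zeroFlats_iff hα hρ]
    refine exists_congr fun a => ?_
    rw [← and_assoc, notMem_base_iff]
    refine and_congr_left fun _ => ⟨fun ha => ⟨⟨ha.1, ?_, ?_⟩, ha.2⟩, fun ha => ⟨ha.1.1, ha.2⟩⟩
    · rintro rfl
      exact ht (z1.mp ha)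
    · rintro rfl
      exact ht (z2.mp ha)
  · ext S
    rw [mem_selfFlats_iff hα hμ]
    refine exists_congr fun a => ?_
    rw [← and_assoc, notMem_base_iff]
    refine and_congr_left fun _ => ⟨fun ha => ⟨⟨ha.1, ?_, ?_⟩, ha.2.trans h1⟩,
      fun ha => ⟨ha.1.1, ha.2.trans h1.symm⟩⟩
    · rintro rfl
      exact ht (s1.mp ha)
    · rintro rfl
      exact ht (s2.mp ha)

/-- Now both exceptional directions are admissible; the flats they give are split off, with `ν` and
`η` replacing the values of `ρ` there. -/
theorem zeroFlats_of_absTrace_eq_zero (hα : α ≠ 0) (hω : ω ^ 2 + ω = 1)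
    (ht : absTrace ω = 0) {ρ : F → F}
    (hρ : ∀ a : F, a ∉ ({0, α} : Set F) → IsRootChoice (α / (a + α)) (ρ a)) {ν η : F}
    (hν : ν ^ 2 + ν = ω) (hη : η ^ 2 + η = ω ^ 2) :
    zeroFlats α =
      {{0, α * ω, α * ω * ν, α * ω * (ν + 1)},
        {0, α * ω ^ 2, α * ω ^ 2 * η, α * ω ^ 2 * (η + 1)}} ∪
      {S : Set F | ∃ a : F, a ∉ ({0, α, α * ω, α * ω ^ 2} : Set F) ∧
        absTrace (α / (a + α)) = 0 ∧ S = {0, a, a * ρ a, a * ρ a + a}} := by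
  have h2 := two_eq_zero_of_algebra_zmod_two F
  obtain ⟨z1, z2⟩ := exceptional_mem_zeroDirections_iff hα hω
  obtain ⟨e1, e2, -⟩ := div_eq_of_sq_add_self h2 hα hω
  replace z1 := z1.mpr ht
  replace z2 := z2.mpr ht
  have f1 : ({0, α * ω, α * ω * ρ (α * ω), α * ω * ρ (α * ω) + α * ω} : Set F) =
      {0, α * ω, α * ω * ν, α * ω * (ν + 1)} := by
    rw [mul_add_one (α * ω)]
    exact flat_eq_of_quadratic_eq h2 ((quadratic_of_isRootChoice z1.2 (hρ _ z1.1)).trans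
      (e1.trans hν.symm))
  have f2 : ({0, α * ω ^ 2, α * ω ^ 2 * ρ (α * ω ^ 2),
      α * ω ^ 2 * ρ (α * ω ^ 2) + α * ω ^ 2} : Set F) =
      {0, α * ω ^ 2, α * ω ^ 2 * η, α * ω ^ 2 * (η + 1)} := by
    rw [mul_add_one (α * ω ^ 2)]
    exact flat_eq_of_quadratic_eq h2 ((quadratic_of_isRootChoice z2.2 (hρ _ z2.1)).trans
      (e2.trans hη.symm))
  ext S
  rw [mem_zeroFlats_iff hα hρ, ← f1, ← f2]
  simp only [Set.mem_union, Set.mem_insert_iff, Set.mem_singleton_iff, Set.mem_ofPred_eq,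
    ↓notMem_base_iff]
  constructor
  · rintro ⟨a, ha, rfl⟩
    by_cases h : a = α * ω
    · exact .inl (.inl (by rw [h]))
    by_cases h' : a = α * ω ^ 2
    · exact .inl (.inr (by rw [h']))
    exact .inr ⟨a, ⟨ha.1, h, h'⟩, ha.2, rfl⟩
  · rintro ((rfl | rfl) | ⟨a, ha, ha', rfl⟩)
    exacts [⟨_, z1, rfl⟩, ⟨_, z2, rfl⟩, ⟨a, ⟨ha.1, ha'⟩, rfl⟩]

theorem selfFlats_of_absTrace_eq_zero (hα : α ≠ 0) (hω : ω ^ 2 + ω = 1)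
    (h1 : absTrace (1 : F) = 0) (ht : absTrace ω = 0) {μ : F → F}
    (hμ : ∀ a : F, a ∉ ({0, α} : Set F) → IsRootChoice ((a + α) / a) (μ a)) {ν η : F}
    (hν : ν ^ 2 + ν = ω) (hη : η ^ 2 + η = ω ^ 2) :
    selfFlats α =
      {{α, α * ω ^ 2, α * ω * ν, α * ω * (ν + 1)},
        {α, α * ω, α * ω ^ 2 * η, α * ω ^ 2 * (η + 1)}} ∪
      {S : Set F | ∃ a : F, a ∉ ({0, α, α * ω, α * ω ^ 2} : Set F) ∧
        absTrace (α / a) = 0 ∧ S = {α, α + a, a * μ a, a * μ a + a}} := by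
  have h2 := two_eq_zero_of_algebra_zmod_two F
  obtain ⟨n1, n2, -⟩ := pairwise_ne_of_sq_add_self h2 hα hω
  obtain ⟨s1, s2⟩ := exceptional_mem_selfDirections_iff hα hω h1
  obtain ⟨e1, e2⟩ := add_div_eq_of_sq_add_self h2 hα hω
  replace s1 := s1.mpr ht
  replace s2 := s2.mpr ht
  have f1 : ({α, α + α * ω, α * ω * μ (α * ω), α * ω * μ (α * ω) + α * ω} : Set F) =
      {α, α * ω ^ 2, α * ω * ν, α * ω * (ν + 1)} := by
    -- Direction `αω` from `α` ends at `αω²`, and conversely, which explains the crossed pairing of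
    -- second points.
    rw [mul_add_one (α * ω), show α * ω ^ 2 = α + α * ω by grind]
    exact flat_eq_of_quadratic_eq h2 ((quadratic_of_isRootChoice
      ((absTrace_self_div_eq_iff n1).mp s1.2) (hμ _ s1.1)).trans (e1.trans hν.symm))
  have f2 : ({α, α + α * ω ^ 2, α * ω ^ 2 * μ (α * ω ^ 2),
      α * ω ^ 2 * μ (α * ω ^ 2) + α * ω ^ 2} : Set F) =
      {α, α * ω, α * ω ^ 2 * η, α * ω ^ 2 * (η + 1)} := by
    rw [mul_add_one (α * ω ^ 2), show α + α * ω ^ 2 = α * ω by grind]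
    exact flat_eq_of_quadratic_eq h2 ((quadratic_of_isRootChoice
      ((absTrace_self_div_eq_iff n2).mp s2.2) (hμ _ s2.1)).trans (e2.trans hη.symm))
  ext S
  rw [mem_selfFlats_iff hα hμ, ← f1, ← f2]
  simp only [Set.mem_union, Set.mem_insert_iff, Set.mem_singleton_iff, Set.mem_ofPred_eq,
    ↓notMem_base_iff]
  constructor
  · rintro ⟨a, ha, rfl⟩
    by_cases h : a = α * ω
    · exact .inl (.inl (by rw [h]))
    by_cases h' : a = α * ω ^ 2
    · exact .inl (.inr (by rw [h']))
    exact .inr ⟨a, ⟨ha.1, h, h'⟩, ha.2.trans h1, rfl⟩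
  · rintro ((rfl | rfl) | ⟨a, ha, ha', rfl⟩)
    exacts [⟨_, s1, rfl⟩, ⟨_, s2, rfl⟩, ⟨a, ⟨ha.1, ha'.trans h1.symm⟩, rfl⟩]

/-! ### Counting the flats -/

theorem three_mul_ncard_vanishingFlats (hα : α ≠ 0) :
    3 * (vanishingFlats (modifiedInverse α)).ncard = 3 * (bothFlats α).ncard +
      (zeroDirections α ∪ selfDirections α).ncard +
      (zeroDirections α ∩ selfDirections α).ncard := by
  rw [ncard_vanishingFlats_modifiedInverse (two_eq_zero_of_algebra_zmod_two F), add_assoc (3 * _),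
    Set.ncard_union_add_ncard_inter, ncard_zeroDirections hα, ncard_selfDirections hα]
  ring

theorem three_mul_ncard_of_odd {n : ℕ} (hF : Fintype.card F = 2 ^ n) (hα : α ≠ 0)
    (hw : ∀ w : F, w ^ 2 + w ≠ 1) :
    3 * (vanishingFlats (modifiedInverse α)).ncard + (rowSpectrum (modifiedInverse α)).ncard + 1 =
      2 ^ n + (zeroDirections α ∩ selfDirections α).ncard := by
  have hk := ncard_rowSpectrum_add_ncard_compl α hF
  rw [compl_rowSpectrum_modifiedInverse hα,
    bothFlats_eq_empty (two_eq_zero_of_algebra_zmod_two F) hα hw, Set.sUnion_empty,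
    Set.union_empty, Set.ncard_insert_of_notMem (by simp [zeroDirections, selfDirections])] at hk
  rw [three_mul_ncard_vanishingFlats hα,
    bothFlats_eq_empty (two_eq_zero_of_algebra_zmod_two F) hα hw, Set.ncard_empty]
  omega

theorem three_mul_ncard_of_absTrace_ne_zero {n : ℕ} (hF : Fintype.card F = 2 ^ n) (hα : α ≠ 0)
    (hω : ω ^ 2 + ω = 1) (h1 : absTrace (1 : F) = 0) (ht : absTrace ω ≠ 0) :
    3 * (vanishingFlats (modifiedInverse α)).ncard + (rowSpectrum (modifiedInverse α)).ncard + 1 =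
      2 ^ n + ((zeroDirections α ∩ selfDirections α) \ {α * ω, α * ω ^ 2}).ncard := by
  have h2 := two_eq_zero_of_algebra_zmod_two F
  obtain ⟨z1, z2⟩ := exceptional_mem_zeroDirections_iff hα hω
  obtain ⟨s1, s2⟩ := exceptional_mem_selfDirections_iff hα hω h1
  have hk := ncard_rowSpectrum_add_ncard_compl α hF
  -- `E` is disjoint from the directions, so the constant is `3 - 4 = -1`: 3 from the flat `E`, 4
  -- from its points.
  rw [compl_rowSpectrum_of_sq_add_self hα hω, Set.ncard_union_eq, ncard_base h2 hα hω] at hk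
  · rw [three_mul_ncard_vanishingFlats hα, bothFlats_eq_singleton h2 hα hω, Set.ncard_singleton,
      sdiff_eq_left.mpr]
    · omega
    · rw [Set.disjoint_right]
      rintro a (rfl | rfl) h
      exacts [ht (z1.mp h.1), ht (z2.mp h.1)]
  · rw [Set.disjoint_left]
    rintro a (rfl | rfl | rfl | rfl) (h | h)
    exacts [h.1 (by simp), h.1 (by simp), h.1 (by simp), h.1 (by simp), ht (z1.mp h),
      ht (s1.mp h), ht (z2.mp h), ht (s2.mp h)]

theorem three_mul_ncard_of_absTrace_eq_zero {n : ℕ} (hF : Fintype.card F = 2 ^ n) (hα : α ≠ 0)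
    (hω : ω ^ 2 + ω = 1) (h1 : absTrace (1 : F) = 0) (ht : absTrace ω = 0) :
    3 * (vanishingFlats (modifiedInverse α)).ncard + (rowSpectrum (modifiedInverse α)).ncard =
      2 ^ n + ((zeroDirections α ∩ selfDirections α) \ {α * ω, α * ω ^ 2}).ncard + 3 := by
  have h2 := two_eq_zero_of_algebra_zmod_two F
  obtain ⟨z1, z2⟩ := exceptional_mem_zeroDirections_iff hα hω
  obtain ⟨s1, s2⟩ := exceptional_mem_selfDirections_iff hα hω h1
  have hk := ncard_rowSpectrum_add_ncard_compl α hF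
  -- Here `αω` and `αω²` are already directions of both kinds: `E` adds only 2 points to the
  -- complement, and the intersection exceeds `s` by 2. The constant is `3 - 2 + 2 = 3`.
  have hU : ({0, α, α * ω, α * ω ^ 2} ∪ (zeroDirections α ∪ selfDirections α) : Set F) =
      {0, α} ∪ (zeroDirections α ∪ selfDirections α) := by
    ext a
    simp only [Set.mem_union, Set.mem_insert_iff, Set.mem_singleton_iff]
    constructor
    · rintro ((rfl | rfl | rfl | rfl) | h)
      exacts [.inl (.inl rfl), .inl (.inr rfl), .inr (.inl (z1.mpr ht)), .inr (.inl (z2.mpr ht)),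
        .inr h]
    · tauto
  have hsub : ({α * ω, α * ω ^ 2} : Set F) ⊆ zeroDirections α ∩ selfDirections α := by
    rintro a (rfl | rfl)
    exacts [⟨z1.mpr ht, s1.mpr ht⟩, ⟨z2.mpr ht, s2.mpr ht⟩]
  have hs := Set.ncard_sdiff_add_ncard_of_subset hsub
  rw [Set.ncard_pair (pairwise_ne_of_sq_add_self h2 hα hω).2.2.2.2] at hs
  rw [compl_rowSpectrum_of_sq_add_self hα hω, hU, Set.ncard_union_eq,
    Set.ncard_pair (Ne.symm hα)] at hk
  · rw [three_mul_ncard_vanishingFlats hα, bothFlats_eq_singleton h2 hα hω, Set.ncard_singleton]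
    omega
  · rw [Set.disjoint_left]
    rintro a (rfl | rfl) (h | h) <;> exact h.1 (by simp)

end Even

/-! ### Assembly of the cases modulo 4 -/

theorem theorem7 {F : Type*} [Field F] [Fintype F] [Algebra (ZMod 2) F]
    (n : ℕ) (hF : Fintype.card F = 2 ^ n)
    (α : F) (hα : α ≠ 0)
    (ρ μ : F → F)
    (hρ : ∀ a : F, a ∉ ({0, α} : Set F) → IsRootChoice (α / (a + α)) (ρ a))
    (hμ : ∀ a : F, a ∉ ({0, α} : Set F) → IsRootChoice ((a + α) / a) (μ a)) :
    (Odd n →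
      vanishingFlats (modifiedInverse α) =
          {S : Set F | ∃ a : F, a ∉ ({0, α} : Set F) ∧ absTrace (α / (a + α)) = 0 ∧
            S = {0, a, a * ρ a, a * ρ a + a}} ∪
          {S : Set F | ∃ a : F, a ∉ ({0, α} : Set F) ∧ absTrace (α / a) = 1 ∧
            S = {α, α + a, a * μ a, a * μ a + a}} ∧
      ((vanishingFlats (modifiedInverse α)).ncard : ℚ) =
        1 / 3 * ((2 : ℚ) ^ n +
          ({a : F | a ∉ ({0, α} : Set F) ∧ absTrace (α / (a + α)) = 0 ∧
            absTrace (α / a) = 1}.ncard : ℚ) -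
          ((rowSpectrum (modifiedInverse α)).ncard : ℚ) - 1)) ∧
    (∀ ω ∈ F4DiffF2 F,
      (n ≡ 2 [MOD 4] →
        vanishingFlats (modifiedInverse α) =
            {{0, α, α * ω, α * ω ^ 2}} ∪
            {S : Set F | ∃ a : F, a ∉ ({0, α, α * ω, α * ω ^ 2} : Set F) ∧
              absTrace (α / (a + α)) = 0 ∧ S = {0, a, a * ρ a, a * ρ a + a}} ∪
            {S : Set F | ∃ a : F, a ∉ ({0, α, α * ω, α * ω ^ 2} : Set F) ∧
              absTrace (α / a) = 0 ∧ S = {α, α + a, a * μ a, a * μ a + a}} ∧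
        ((vanishingFlats (modifiedInverse α)).ncard : ℚ) =
          1 / 3 * ((2 : ℚ) ^ n +
            ({a : F | a ∉ ({0, α, α * ω, α * ω ^ 2} : Set F) ∧
              absTrace (α / (a + α)) = 0 ∧ absTrace (α / a) = 0}.ncard : ℚ) -
            ((rowSpectrum (modifiedInverse α)).ncard : ℚ) - 1)) ∧
      (n ≡ 0 [MOD 4] →
        (∀ ν η : F, IsRootChoice ω ν → IsRootChoice (ω ^ 2) η →
          vanishingFlats (modifiedInverse α) =
            {{0, α, α * ω, α * ω ^ 2},
              {0, α * ω, α * ω * ν, α * ω * (ν + 1)},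
              {α, α * ω ^ 2, α * ω * ν, α * ω * (ν + 1)},
              {0, α * ω ^ 2, α * ω ^ 2 * η, α * ω ^ 2 * (η + 1)},
              {α, α * ω, α * ω ^ 2 * η, α * ω ^ 2 * (η + 1)}} ∪
            {S : Set F | ∃ a : F, a ∉ ({0, α, α * ω, α * ω ^ 2} : Set F) ∧
              absTrace (α / (a + α)) = 0 ∧ S = {0, a, a * ρ a, a * ρ a + a}} ∪
            {S : Set F | ∃ a : F, a ∉ ({0, α, α * ω, α * ω ^ 2} : Set F) ∧
              absTrace (α / a) = 0 ∧ S = {α, α + a, a * μ a, a * μ a + a}}) ∧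
        ((vanishingFlats (modifiedInverse α)).ncard : ℚ) =
          1 / 3 * ((2 : ℚ) ^ n +
            ({a : F | a ∉ ({0, α, α * ω, α * ω ^ 2} : Set F) ∧
              absTrace (α / (a + α)) = 0 ∧ absTrace (α / a) = 0}.ncard : ℚ) -
            ((rowSpectrum (modifiedInverse α)).ncard : ℚ) + 3))) := by
  have h2 := two_eq_zero_of_algebra_zmod_two F
  refine ⟨fun hn => ?_, fun ω hω => ⟨fun hn => ?_, fun hn => ?_⟩⟩
  · have h1 : absTrace (1 : F) = 1 := by
      rw [absTrace_one hF]
      exact ZMod.natCast_eq_one_iff_odd.mpr hn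
    have hw (w : F) : w ^ 2 + w ≠ 1 := fun h =>
      one_ne_zero (h1.symm.trans ((absTrace_eq_zero_iff 1).mpr ⟨w, h⟩))
    constructor
    · rw [vanishingFlats_modifiedInverse h2, bothFlats_eq_empty h2 hα hw, Set.empty_union]
      congr 1 <;> ext S
      · rw [mem_zeroFlats_iff hα hρ]
        exact exists_congr fun a => and_assoc
      · rw [mem_selfFlats_iff hα hμ, selfDirections, h1]
        exact exists_congr fun a => and_assoc
    · have hs : {a : F | a ∉ ({0, α} : Set F) ∧ absTrace (α / (a + α)) = 0 ∧
          absTrace (α / a) = 1} = zeroDirections α ∩ selfDirections α := by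
        ext a
        simp only [zeroDirections, selfDirections, Set.mem_inter_iff, Set.mem_ofPred_eq, h1]
        tauto
      have h := congrArg (Nat.cast : ℕ → ℚ) (three_mul_ncard_of_odd hF hα hw)
      push_cast at h
      rw [hs]
      linarith
  · have hne : Even n := Nat.even_iff.mpr (by simp only [Nat.ModEq] at hn; omega)
    have hω' := sq_add_self_of_mem_F4DiffF2 h2 hω
    have h1 := absTrace_one_of_even hF hne
    have ht : absTrace ω ≠ 0 := by
      rw [absTrace_eq_half hF hne hω', Ne, ZMod.natCast_eq_zero_iff_even, Nat.even_iff]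
      simp only [Nat.ModEq] at hn
      omega
    refine ⟨vanishingFlats_of_absTrace_ne_zero hα hω' h1 ht hρ hμ, ?_⟩
    have h := congrArg (Nat.cast : ℕ → ℚ) (three_mul_ncard_of_absTrace_ne_zero hF hα hω' h1 ht)
    push_cast at h
    rw [common_directions_eq h1]
    linarith
  · have hne : Even n := Nat.even_iff.mpr (by simp only [Nat.ModEq] at hn; omega)
    have hω' := sq_add_self_of_mem_F4DiffF2 h2 hω
    have h1 := absTrace_one_of_even hF hne
    have ht : absTrace ω = 0 := by
      rw [absTrace_eq_half hF hne hω', ZMod.natCast_eq_zero_iff_even, Nat.even_iff]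
      simp only [Nat.ModEq] at hn
      omega
    constructor
    · intro ν η hν hη
      have hν' := quadratic_of_isRootChoice ht hν
      have hη' := quadratic_of_isRootChoice ((absTrace_sq ω).trans ht) hη
      rw [vanishingFlats_modifiedInverse h2, bothFlats_eq_singleton h2 hα hω',
        zeroFlats_of_absTrace_eq_zero hα hω' ht hρ hν' hη',
        selfFlats_of_absTrace_eq_zero hα hω' h1 ht hμ hν' hη']
      ext S
      simp only [Set.mem_union, Set.mem_insert_iff, Set.mem_singleton_iff]
      tauto
    · have h := congrArg (Nat.cast : ℕ → ℚ)
        (three_mul_ncard_of_absTrace_eq_zero hF hα hω' h1 ht)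
      push_cast at h
      rw [common_directions_eq h1]
      linarith
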